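/- Let $G$ be a finite plane directed graph (loops and parallel arcs are allowed, and each undirected edge consists of an arc and its reversal, either of which may be absent, that is, have capacity $0$), with capacities $c(e)\in[0,\infty]$ on arcs and $c(v)\in[0,\infty]$ on vertices, and with disjoint sets $S$ of sources and $T$ of sinks, such that no arc enters a source, no arc leaves a sink, and all terminals (vertices of $S\cup T$) have infinite capacity. Let $k=|S|+|T|\ge 2$. Here "plane" means that the clockwise cyclic orders of the edges around the vertices form a combinatorial embedding of genus $0$. Let $G_{st}$ be obtained from $G$ by adding a supersource $s$, a supersink $t$ (both of infinite capacity) and infinite-capacity arcs $(s,s_i)$ for $s_i\in S$ and $(t_i,t)$ for $t_i\in T$; its only source is $s$ and its only sink is $t$. The extended graph $G^\circ$ is obtained from $G_{st}$ by replacing each vertex $v$ of finite capacity by an undirected cycle on $\deg(v)$ vertices, each edge of which has capacity $c(v)/2$ in both directions, and attaching the edges that were incident to $v$ to distinct vertices of the cycle in their clockwise order. $G^\circ$ has no vertex capacities. A flow is a nonnegative function on the arcs that satisfies conservation at all non-terminals; it is feasible if it also respects all arc and vertex capacities, and acyclic if no directed cycle consists of arcs that all carry positive flow. Let $f^\circ$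 be a feasible flow in $G^\circ$ whose restriction $f$ to the arcs of $G$ is acyclic. For a vertex $v$ of $G$ let $f^{in}(v)$ be the total flow into $v$, let $ex(f,v)=\max\{0,f^{in}(v)-c(v)\}$, and call $v$ infeasible if $f^{in}(v)>c(v)$. Let $\alpha(v)$ be the number of changes between incoming and outgoing in the clockwise cyclic sequence of the arcs at $v$ that carry positive flow, let $index(v)=\alpha(v)/2-1$, and call $v$ a saddle if $\alpha(v)\ge 4$. Then: 1. $f$ is a flow in $G$ that respects all arc capacities. 2. For each non-terminal vertex $v$ incident to an arc that carries positive flow, $ex(f,v)\le index(v)\,c(v)$ (with $0\cdot\infty=0$). 3. Every infeasible vertex of $f$ is a saddle. 4. The sum of $index(v)$ over all saddles $v$ is at most $k-2$. 5. At most $k-2$ vertices are infeasible under $f$. 6. If $U\in[0,\infty)$ is at least every finite vertex capacity, then $\sum_{v\in V(G)} ex(f,v)\le (k-2)U$. -/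

import Mathlib

open scoped NNReal ENNReal

/-- A flow network on a finite directed multigraph with vertex set `V` and arc set `A`.
Every arc `a` has a reversal `rev a`; an arc of capacity `0` can carry no flow, so it stands for an
arc that is absent. An undirected edge of the underlying graph is a pair `{a, rev a}`.
Capacities lie in `[0, ∞]`; `S` is the set of sources and `T` the set of sinks. -/
structure FlowNetwork (V A : Type*) where
  tail : A → V
  rev : Equiv.Perm A
  rev_rev : ∀ a, rev (rev a) = a
  rev_ne : ∀ a, rev a ≠ a
  cap : A → ℝ≥0∞
  vcap : V → ℝ≥0∞
  S : Set V
  T : Set V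

namespace FlowNetwork

variable {V A : Type*}

/-- The vertex at which an arc ends. -/
def head (N : FlowNetwork V A) (a : A) : V := N.tail (N.rev a)

/-! ### Flows -/

open Classical in
/-- `f^in(v)`: the total flow on the arcs directed into `v`. -/
noncomputable def inflow [Fintype A] (N : FlowNetwork V A) (f : A → ℝ≥0) (v : V) : ℝ≥0 :=
  ∑ a with N.head a = v, f a

open Classical in
/-- `f^out(v)`: the total flow on the arcs directed out of `v`. -/
noncomputable def outflow [Fintype A] (N : FlowNetwork V A) (f : A → ℝ≥0) (v : V) : ℝ≥0 :=
  ∑ a with N.tail a = v, f a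

/-- Flow conservation at every vertex that is not a terminal. -/
def IsFlow [Fintype A] (N : FlowNetwork V A) (f : A → ℝ≥0) : Prop :=
  ∀ v, v ∉ N.S ∪ N.T → N.inflow f v = N.outflow f v

/-- The arc capacity constraints. -/
def RespectsArcCapacities (N : FlowNetwork V A) (f : A → ℝ≥0) : Prop :=
  ∀ a, (f a : ℝ≥0∞) ≤ N.cap a

/-- A feasible flow: conservation, arc capacities and vertex capacities. -/
def IsFeasible [Fintype A] (N : FlowNetwork V A) (f : A → ℝ≥0) : Prop :=
  N.IsFlow f ∧ N.RespectsArcCapacities f ∧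
    ∀ v, v ∉ N.S ∪ N.T → (N.inflow f v : ℝ≥0∞) ≤ N.vcap v

/-- Some arc from `u` to `v` carries flow. -/
def FlowStep (N : FlowNetwork V A) (f : A → ℝ≥0) (u v : V) : Prop :=
  ∃ a, N.tail a = u ∧ N.head a = v ∧ 0 < f a

/-- `f` is acyclic: there is no closed sequence of (one or more) arcs that all carry flow. -/
def IsAcyclic (N : FlowNetwork V A) (f : A → ℝ≥0) : Prop :=
  ∀ v, ¬ Relation.TransGen (N.FlowStep f) v v

/-- The vertex `v` is infeasible under `f`. -/
def IsInfeasibleAt [Fintype A] (N : FlowNetwork V A) (f : A → ℝ≥0) (v : V) : Prop :=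
  N.vcap v < (N.inflow f v : ℝ≥0∞)

/-- The excess `max {0, f^in(v) - c(v)}`; subtraction in `ℝ≥0∞` is truncated at `0`, and the excess
is `0` when `c(v) = ∞`. -/
noncomputable def excess [Fintype A] (N : FlowNetwork V A) (f : A → ℝ≥0) (v : V) : ℝ≥0∞ :=
  (N.inflow f v : ℝ≥0∞) - N.vcap v

/-! ### Plane embeddings -/

/-- The number of orbits on `A` of the group generated by a set of permutations of `A`. -/
noncomputable def numOrbits (P : Set (Equiv.Perm A)) : ℕ :=
  Nat.card (MulAction.orbitRel.Quotient (Subgroup.closure P) A)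

/-- A plane graph, given as a combinatorial embedding (rotation system) of genus `0`.
At each vertex `v`, the end at `v` of an undirected edge `{a, rev a}` is represented by the arc of
this pair whose tail is `v`. The permutation `next` sends each end to the next one in clockwise
order around its vertex. The orbits of `next` are the vertices that are not isolated, those of `rev`
the undirected edges, those of `next * rev` the face boundaries, and those of the group generated by
`next` and `rev` the connected components that have an edge. The embedding is planar if
`#vertices - #edges + #faces = 2 * #components`. -/
structure PlaneEmbedding (N : FlowNetwork V A) where
  next : Equiv.Perm A
  tail_next : ∀ a, N.tail (next a) = N.tail a
  sameCycle_next : ∀ a b, N.tail a = N.tail b → next.SameCycle a b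
  planar : (numOrbits {next} : ℤ) - numOrbits {N.rev} + numOrbits {next * N.rev}
    = 2 * numOrbits {next, N.rev}

/-! ### Alternation number, index and saddles -/

/-- The undirected edge with end `a` carries flow in one of its two directions. -/
def CarriesFlow (N : FlowNetwork V A) (f : A → ℝ≥0) (a : A) : Prop :=
  0 < f a ∨ 0 < f (N.rev a)

/-- `v` is an endpoint of an arc that carries flow. -/
def IsActive (N : FlowNetwork V A) (f : A → ℝ≥0) (v : V) : Prop :=
  ∃ a, N.tail a = v ∧ N.CarriesFlow f a

namespace PlaneEmbedding

variable {N : FlowNetwork V A}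

/-- Among the flow-carrying ends around a vertex, the one that follows `a` clockwise
is directed differently (one is outgoing, the other incoming). -/
def IsDirectionChange (P : N.PlaneEmbedding) (f : A → ℝ≥0) (a : A) : Prop :=
  N.CarriesFlow f a ∧ ∃ n : ℕ,
    N.CarriesFlow f ((P.next ^ (n + 1)) a) ∧
    (∀ m < n, ¬ N.CarriesFlow f ((P.next ^ (m + 1)) a)) ∧
    ¬ (0 < f ((P.next ^ (n + 1)) a) ↔ 0 < f a)

/-- The alternation number `α(v)`: the number of direction changes of the flow-carrying arcs
incident to `v`, in clockwise order. -/
noncomputable def alternation (P : N.PlaneEmbedding) (f : A → ℝ≥0) (v : V) : ℕ :=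
  {a | N.tail a = v ∧ P.IsDirectionChange f a}.ncard

/-- `index(v) = α(v) / 2 - 1`. -/
noncomputable def index (P : N.PlaneEmbedding) (f : A → ℝ≥0) (v : V) : ℝ :=
  (P.alternation f v : ℝ) / 2 - 1

/-- A saddle is a vertex with alternation number at least `4`. -/
def IsSaddle (P : N.PlaneEmbedding) (f : A → ℝ≥0) (v : V) : Prop :=
  4 ≤ P.alternation f v

end PlaneEmbedding

/-! ### The network with a supersource and a supersink -/

/-- Vertices of `G_st`. -/
inductive StVertex (V : Type*) where
  | base (v : V)
  | supersource
  | supersink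

/-- Arcs of `G_st`: those of `G`, and for each source `s` (each sink `t`) a pair of mutually reverse
arcs, of which the one tagged `true` is directed from the supersource to `s` (from `t` to the
supersink). -/
abbrev StArc (N : FlowNetwork V A) : Type _ := A ⊕ ((N.S ⊕ N.T) × Bool)

/-- The network `G_st`. The new arcs have infinite capacity and their reversals capacity `0`. -/
noncomputable def stNetwork (N : FlowNetwork V A) : FlowNetwork (StVertex V) N.StArc where
  tail
    | .inl a => .base (N.tail a)
    | .inr (.inl _, true) => .supersource
    | .inr (.inl s, false) => .base s
    | .inr (.inr t, true) => .base t
    | .inr (.inr _, false) => .supersink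
  rev := Equiv.sumCongr N.rev (Equiv.prodCongr (Equiv.refl _) Equiv.boolNot)
  rev_rev := by rintro (a | ⟨x, b⟩) <;> simp [N.rev_rev]
  rev_ne := by rintro (a | ⟨x, b⟩) <;> simp [N.rev_ne]
  cap
    | .inl a => N.cap a
    | .inr (_, true) => ⊤
    | .inr (_, false) => 0
  vcap
    | .base v => N.vcap v
    | _ => ⊤
  S := {.supersource}
  T := {.supersink}

/-! ### Replacing finitely capacitated vertices by cycles -/

/-- The edge ends at the finitely capacitated vertices. -/
abbrev FiniteEnd (N : FlowNetwork V A) : Type _ := {a : A // N.vcap (N.tail a) ≠ ⊤}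

/-- A finitely capacitated vertex `v` is replaced by one new vertex for each edge end at `v`;
a vertex of infinite capacity is kept. -/
abbrev CycleVertex (N : FlowNetwork V A) : Type _ := N.FiniteEnd ⊕ {v : V // N.vcap v = ⊤}

/-- The old arcs, and for each edge end `x` at a finitely capacitated vertex the two arcs of an
undirected edge of the cycle, from `x` to the next end (tagged `true`) and back (`false`). -/
abbrev CycleArc (N : FlowNetwork V A) : Type _ := A ⊕ (N.FiniteEnd × Bool)

open Classical in
/-- The new vertex at which the edge end `a` is attached. -/
noncomputable def port (N : FlowNetwork V A) (a : A) : N.CycleVertex :=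
  if h : N.vcap (N.tail a) = ⊤ then .inr ⟨N.tail a, h⟩ else .inl ⟨a, h⟩

/-- The old vertex from which a new vertex comes. -/
def origin (N : FlowNetwork V A) : N.CycleVertex → V
  | .inl x => N.tail x.1
  | .inr v => v.1

/-- Replace each finitely capacitated vertex `v` by an undirected cycle, with one vertex for each
edge end at `v`, in the cyclic order `next`; each edge of the cycle has capacity `c(v) / 2` in both
directions, and each old edge end at `v` is attached to its own vertex of the cycle. (The cycle is a
loop if `v` has degree `1`, and a pair of parallel edges if `v` has degree `2`.) There are no vertex
capacities any more. -/
noncomputable def replaceByCycles (N : FlowNetwork V A) (next : Equiv.Perm A)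
    (hnext : ∀ a, N.tail (next a) = N.tail a) : FlowNetwork N.CycleVertex N.CycleArc where
  tail
    | .inl a => N.port a
    | .inr (x, true) => .inl x
    | .inr (x, false) => .inl ⟨next x.1, by rw [hnext]; exact x.2⟩
  rev := Equiv.sumCongr N.rev (Equiv.prodCongr (Equiv.refl _) Equiv.boolNot)
  rev_rev := by rintro (a | ⟨x, b⟩) <;> simp [N.rev_rev]
  rev_ne := by rintro (a | ⟨x, b⟩) <;> simp [N.rev_ne]
  cap
    | .inl a => N.cap a
    | .inr (x, _) => N.vcap (N.tail x.1) / 2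
  vcap _ := ⊤
  S := {x | N.origin x ∈ N.S}
  T := {x | N.origin x ∈ N.T}

/-! ### The extended graph -/

/-- Vertices of the extended graph `G°`. -/
abbrev ExtVertex (N : FlowNetwork V A) : Type _ := N.stNetwork.CycleVertex

/-- Arcs of the extended graph `G°`. -/
abbrev ExtArc (N : FlowNetwork V A) : Type _ := N.stNetwork.CycleArc

/-- The clockwise order of the edge ends of `G`, viewed in `G_st`. It is only used at finitely
capacitated vertices, which are not incident to the new arcs when terminals have infinite
capacity; the value on the new arcs is irrelevant. -/
def PlaneEmbedding.stNext {N : FlowNetwork V A} (P : N.PlaneEmbedding) : Equiv.Perm N.StArc :=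
  Equiv.sumCongr P.next (Equiv.refl _)

theorem PlaneEmbedding.tail_stNext {N : FlowNetwork V A} (P : N.PlaneEmbedding) (a : N.StArc) :
    N.stNetwork.tail (P.stNext a) = N.stNetwork.tail a := by
  rcases a with a | a
  · simp [stNetwork, PlaneEmbedding.stNext, P.tail_next]
  · rfl

/-- The extended graph `G°`: in `G_st`, replace each finitely capacitated vertex by a cycle. -/
noncomputable def extended (N : FlowNetwork V A) (P : N.PlaneEmbedding) :
    FlowNetwork N.ExtVertex N.ExtArc :=
  N.stNetwork.replaceByCycles P.stNext P.tail_stNext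

open Classical in
noncomputable instance instFintypeExtArc [Fintype V] [Fintype A] (N : FlowNetwork V A) :
    Fintype N.ExtArc :=
  inferInstanceAs (Fintype ((A ⊕ ((N.S ⊕ N.T) × Bool)) ⊕ (N.stNetwork.FiniteEnd × Bool)))

/-- The restriction to `G` of a flow in `G°`. -/
def restrict (N : FlowNetwork V A) (g : N.ExtArc → ℝ≥0) : A → ℝ≥0 :=
  fun a => g (.inl (.inl a))

end FlowNetwork

/-! ### Orbit counts of sets of permutations -/

namespace Setoid

variable {A : Type*}

/-! The argument has a local and a global half, linked by the alternation number `α(v)`.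

Local: if `c(v)` is finite, let `r a` be the net flow on the cycle edge between the ends `a` and
`next a`; both directions have capacity `c(v)/2`, so `|r a| ≤ c(v)/2`. Conservation on the cycle
makes the net outflow of `f` at `next a` equal to `r (next a) - r a`. Summing this around `v` gives
conservation of `f`. Summing it with weight `-1` on incoming ends and `0` on outgoing ones gives
`f^in(v)`. By summation by parts only the `α(v)` positions where the weight jumps contribute, at
most `c(v)/2` each, so `f^in(v) ≤ (index(v) + 1) c(v)` (`sum_weighted_netflow`,
`IsFeasible.inflow_le_alternation`).

Global: delete all edges without flow, which does not increase the genus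
(`eulerDefect_le_of_restrict`). Each end of a remaining edge is a direction change either at its
vertex or on its face, never both (`card_changes`). By acyclicity no face boundary is a directed
closed walk, so every face with an edge has at least two changes. With Euler's formula the indices
of all vertices carrying flow sum to at most `-2` (`sum_alternation_add_four_le`). Among the
non-saddles, only terminals can have negative index, and then at least `-1`; moving them to the
other side leaves at most `k - 2` for the saddles.

Since `α` is even, positive excess forces `α ≥ 4`, hence index at least `1`. The bounds on the
number of infeasible vertices and on the total excess follow by summation. -/

open Classical in
/-- The equivalence relation obtained from `r` by merging the classes of `a` and `b`. -/
noncomputable def merge (r : Setoid A) (a b : A) : Setoid A :=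
  Setoid.ker fun x => if r x b then (Quotient.mk r a) else Quotient.mk r x

open Classical in
theorem merge_apply (r : Setoid A) (a b x y : A) : r.merge a b x y ↔
    (if r x b then Quotient.mk r a else Quotient.mk r x)
      = if r y b then Quotient.mk r a else Quotient.mk r y := Iff.rfl

theorem le_merge (r : Setoid A) (a b : A) : r ≤ r.merge a b := by
  intro x y h
  have hb : r x b ↔ r y b := ⟨fun h' => r.trans (r.symm h) h', fun h' => r.trans h h'⟩
  have hq : Quotient.mk r x = Quotient.mk r y := Quotient.sound h
  rw [merge_apply, hq]
  by_cases h' : r y b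
  · rw [if_pos h', if_pos (hb.2 h')]
  · rw [if_neg h', if_neg (mt hb.1 h')]

theorem merge_pair (r : Setoid A) (a b : A) : r.merge a b a b := by
  simp [merge_apply]

theorem merge_le {r s : Setoid A} {a b : A} (h : r ≤ s) (hab : s a b) : r.merge a b ≤ s := by
  intro x y hxy
  rw [merge_apply] at hxy
  split_ifs at hxy with h1 h2 h2
  · exact s.trans (h h1) (s.symm (h h2))
  · exact s.trans (h h1) (s.trans (s.symm hab) (h (Quotient.exact hxy)))
  · exact s.trans (h (Quotient.exact hxy)) (s.trans hab (s.symm (h h2)))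
  · exact h (Quotient.exact hxy)

theorem merge_eq_self {r : Setoid A} {a b : A} (hab : r a b) : r.merge a b = r :=
  le_antisymm (merge_le le_rfl hab) (r.le_merge a b)

/-- The map defining `merge` takes as values all classes of `r` except that of `b`. -/
theorem card_merge_of_not_rel [Finite A] {r : Setoid A} {a b : A} (hab : ¬ r a b) :
    Nat.card (Quotient r) = Nat.card (Quotient (r.merge a b)) + 1 := by
  classical
  have := Fintype.ofFinite (Quotient r)
  rw [merge, Nat.card_congr (Setoid.quotientKerEquivRange _)]
  have hr : Set.range (fun x => if r x b then (Quotient.mk r a) else Quotient.mk r x)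
      = ((Finset.univ.erase (Quotient.mk r b) : Finset (Quotient r)) : Set (Quotient r)) := by
    ext q
    induction q using Quotient.inductionOn with | _ y => ?_
    simp only [Set.mem_range, Finset.coe_erase, Finset.coe_univ, Set.mem_sdiff, Set.mem_univ,
      Set.mem_singleton_iff, true_and]
    constructor
    · rintro ⟨x, hx⟩ hy
      rw [hy] at hx
      split_ifs at hx with h
      · exact hab (Quotient.exact hx)
      · exact h (Quotient.exact hx)
    · intro hy
      exact ⟨y, by rw [if_neg fun h => hy (Quotient.sound h)]⟩
  rw [hr, Nat.card_coe_set_eq, Set.ncard_coe_finset, Finset.card_erase_of_mem (Finset.mem_univ _),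
    Nat.card_eq_fintype_card, Finset.card_univ]
  have : 0 < Fintype.card (Quotient r) := Fintype.card_pos_iff.2 ⟨Quotient.mk r b⟩
  omega

end Setoid

namespace FlowNetwork

/-! ### Orbits of permutation groups, and the genus under edge deletion -/

section Orbits

variable {A : Type*}

/-- Being in the same orbit of the group generated by a set of permutations. -/
def orbitSetoid (P : Set (Equiv.Perm A)) : Setoid A :=
  MulAction.orbitRel (Subgroup.closure P) A

theorem numOrbits_eq_card (P : Set (Equiv.Perm A)) :
    numOrbits P = Nat.card (Quotient (orbitSetoid P)) := rfl

theorem orbitSetoid_of_mem_closure {P : Set (Equiv.Perm A)} {p : Equiv.Perm A}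
    (hp : p ∈ Subgroup.closure P) (x : A) : orbitSetoid P x (p x) :=
  (orbitSetoid P).symm ⟨⟨p, hp⟩, rfl⟩

theorem orbitSetoid_of_mem {P : Set (Equiv.Perm A)} {p : Equiv.Perm A} (hp : p ∈ P) (x : A) :
    orbitSetoid P x (p x) :=
  orbitSetoid_of_mem_closure (Subgroup.subset_closure hp) x

theorem orbitSetoid_le {P : Set (Equiv.Perm A)} {s : Setoid A}
    (h : ∀ p ∈ P, ∀ x, s x (p x)) : orbitSetoid P ≤ s := by
  have key : ∀ p ∈ Subgroup.closure P, ∀ x, s x (p x) := by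
    intro p hp
    induction hp using Subgroup.closure_induction with
    | mem p hp => exact h p hp
    | one => exact fun x => s.refl x
    | mul p q _ _ hp hq => exact fun x => s.trans (hq x) (hp (q x))
    | inv p _ hp => exact fun x => s.symm (by simpa using hp (p⁻¹ x))
  rintro x y ⟨⟨p, hp⟩, rfl⟩
  exact s.symm (key p hp y)

theorem orbitSetoid_singleton {τ : Equiv.Perm A} {x y : A} :
    orbitSetoid {τ} x y ↔ τ.SameCycle x y := by
  constructor
  · have : orbitSetoid {τ} ≤ Equiv.Perm.SameCycle.setoid τ := by
      refine orbitSetoid_le fun p hp x => ?_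
      rw [Set.mem_singleton_iff.1 hp]
      exact ⟨1, by simp⟩
    exact fun h => this h
  · rintro ⟨i, rfl⟩
    exact orbitSetoid_of_mem_closure
      (Subgroup.zpow_mem _ (Subgroup.subset_closure (Set.mem_singleton τ)) i) x

open Classical in
theorem orbitSetoid_mul_swap_le (P : Set (Equiv.Perm A)) (τ : Equiv.Perm A) (a b : A) :
    (orbitSetoid (insert (τ * Equiv.swap a b) P)).merge a b
      ≤ (orbitSetoid (insert τ P)).merge a b := by
  refine Setoid.merge_le (orbitSetoid_le ?_) (Setoid.merge_pair _ a b)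
  set s := (orbitSetoid (insert τ P)).merge a b
  have hτ : ∀ x, s x (τ x) := fun x =>
    Setoid.le_merge _ a b (orbitSetoid_of_mem (Set.mem_insert τ P) x)
  have hab : s a b := Setoid.merge_pair _ a b
  rintro p (rfl | hp) x
  · rw [Equiv.Perm.mul_apply]
    refine s.trans ?_ (hτ _)
    by_cases hxa : x = a
    · rw [hxa, Equiv.swap_apply_left]; exact hab
    by_cases hxb : x = b
    · rw [hxb, Equiv.swap_apply_right]; exact s.symm hab
    · rw [Equiv.swap_apply_of_ne_of_ne hxa hxb]
  · exact Setoid.le_merge _ a b (orbitSetoid_of_mem (Set.mem_insert_of_mem τ hp) x)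

-- Once `a` and `b` are identified, composing a generator with their transposition no longer affects
-- the orbits.
open Classical in
theorem merge_orbitSetoid_mul_swap (P : Set (Equiv.Perm A)) (τ : Equiv.Perm A) (a b : A) :
    (orbitSetoid (insert (τ * Equiv.swap a b) P)).merge a b
      = (orbitSetoid (insert τ P)).merge a b := by
  refine le_antisymm (orbitSetoid_mul_swap_le P τ a b) ?_
  simpa [mul_assoc] using orbitSetoid_mul_swap_le P (τ * Equiv.swap a b) a b

variable [Finite A]

-- If `n` is least with `τ^n a = b`, the new permutation sends `b` to `τ a` and then follows `τ`
-- back to `b`, so the orbit of `b` stays among `τ a, ..., τ^n a` and misses `a`.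
open Classical in
theorem not_sameCycle_mul_swap {τ : Equiv.Perm A} {a b : A} (hab : a ≠ b)
    (h : τ.SameCycle a b) : ¬ (τ * Equiv.swap a b).SameCycle a b := by
  obtain ⟨i, hi⟩ : ∃ i, (τ ^ i) a = b := by
    obtain ⟨i, -, hi⟩ := h.exists_pow_eq'
    exact ⟨i, hi⟩
  have hex : ∃ i, (τ ^ i) a = b := ⟨i, hi⟩
  set n := Nat.find hex with hn
  have hnb : (τ ^ n) a = b := Nat.find_spec hex
  have hmin : ∀ m < n, (τ ^ m) a ≠ b := fun m hm => Nat.find_min hex hm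
  have hn0 : n ≠ 0 := fun h0 => hab (by simpa [h0] using hnb)
  have hna : ∀ j, 1 ≤ j → j ≤ n → (τ ^ j) a ≠ a := by
    intro j h1 h2 hj
    refine hmin (n - j) (by omega) ?_
    rw [← hnb]
    conv_rhs => rw [← Nat.sub_add_cancel h2, pow_add, Equiv.Perm.mul_apply, hj]
  have key : ∀ m : ℕ, ∃ j, 1 ≤ j ∧ j ≤ n ∧ ((τ * Equiv.swap a b) ^ m) b = (τ ^ j) a := by
    intro m
    induction m with
    | zero => exact ⟨n, by omega, le_rfl, by simp [hnb]⟩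
    | succ m ih =>
      obtain ⟨j, h1, h2, hj⟩ := ih
      rw [pow_succ', Equiv.Perm.mul_apply, hj, Equiv.Perm.mul_apply]
      rcases eq_or_lt_of_le h2 with rfl | h3
      · exact ⟨1, le_rfl, by omega, by rw [hnb, Equiv.swap_apply_right, pow_one]⟩
      · refine ⟨j + 1, by omega, by omega, ?_⟩
        rw [Equiv.swap_apply_of_ne_of_ne (hna j h1 h2) (hmin j h3), pow_succ',
          Equiv.Perm.mul_apply]
  intro hs
  obtain ⟨m, -, hm⟩ := hs.symm.exists_pow_eq'
  obtain ⟨j, h1, h2, hj⟩ := key m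
  exact hna j h1 h2 (hj.symm.trans hm)

-- The new permutation sends `a` to `τ b` and then runs along the `τ`-cycle of `b`, which avoids
-- `a`, until it reaches `b`.
open Classical in
theorem sameCycle_mul_swap {τ : Equiv.Perm A} {a b : A}
    (h : ¬ τ.SameCycle a b) : (τ * Equiv.swap a b).SameCycle a b := by
  have hex : ∃ i, (τ ^ (i + 1)) b = b := by
    obtain ⟨i, hi, h⟩ := isOfFinOrder_iff_pow_eq_one.1 (isOfFinOrder_of_finite τ)
    exact ⟨i - 1, by rw [Nat.sub_add_cancel hi, h]; rfl⟩
  set n := Nat.find hex with hn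
  have hnb : (τ ^ (n + 1)) b = b := Nat.find_spec hex
  have hmin : ∀ m < n, (τ ^ (m + 1)) b ≠ b := fun m hm => Nat.find_min hex hm
  have key : ∀ j, j ≤ n → (τ * Equiv.swap a b).SameCycle a ((τ ^ (j + 1)) b) := by
    intro j
    induction j with
    | zero => exact fun _ => ⟨1, by simp⟩
    | succ j ih =>
      intro hj
      refine (ih (by omega)).trans ⟨1, ?_⟩
      rw [zpow_one, Equiv.Perm.mul_apply, Equiv.swap_apply_of_ne_of_ne _ (hmin j (by omega)),
        pow_succ' τ (j + 1), Equiv.Perm.mul_apply]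
      rintro h'
      exact h (Equiv.Perm.SameCycle.symm ⟨(j + 1 : ℕ), by rw [zpow_natCast, h']⟩)
  simpa [hnb] using key n le_rfl

open Classical in
/-- Cutting one cycle of a permutation into two. -/
theorem numOrbits_mul_swap {τ : Equiv.Perm A} {a b : A} (hab : a ≠ b) (h : τ.SameCycle a b) :
    numOrbits {τ * Equiv.swap a b} = numOrbits {τ} + 1 := by
  have hm := merge_orbitSetoid_mul_swap ∅ τ a b
  simp only [insert_empty_eq] at hm
  rw [numOrbits_eq_card, numOrbits_eq_card, Setoid.card_merge_of_not_rel (a := a) (b := b), hm,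
    Setoid.merge_eq_self (orbitSetoid_singleton.2 h)]
  exact fun h' => not_sameCycle_mul_swap hab h (orbitSetoid_singleton.1 h')

open Classical in
/-- Joining two cycles of a permutation. -/
theorem numOrbits_mul_swap_of_not {τ : Equiv.Perm A} {a b : A} (h : ¬ τ.SameCycle a b) :
    numOrbits {τ * Equiv.swap a b} + 1 = numOrbits {τ} := by
  have hab : a ≠ b := fun hab => h (hab ▸ Equiv.Perm.SameCycle.refl τ a)
  have := numOrbits_mul_swap hab (sameCycle_mul_swap h)
  simpa [mul_assoc] using this.symm

/-- The Euler characteristic of a hypermap, minus that of a disjoint union of spheres. -/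
noncomputable def eulerDefect (σ α : Equiv.Perm A) : ℤ :=
  (numOrbits {σ} : ℤ) + numOrbits {α} + numOrbits {σ * α} - Nat.card A - 2 * numOrbits {σ, α}

open Classical in
/-- Deleting an edge does not increase the genus. -/
theorem eulerDefect_le_mul_swap (σ α : Equiv.Perm A) {a b : A} (hab : a ≠ b)
    (h : α.SameCycle a b) : eulerDefect σ α ≤ eulerDefect σ (α * Equiv.swap a b) := by
  have hα := numOrbits_mul_swap hab h
  have hm := merge_orbitSetoid_mul_swap {σ} α a b
  have hle : orbitSetoid {α} ≤ orbitSetoid (insert α {σ}) :=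
    orbitSetoid_le fun p hp x => orbitSetoid_of_mem (by simp_all) x
  have hc : orbitSetoid (insert α {σ}) a b := hle (orbitSetoid_singleton.2 h)
  rw [Setoid.merge_eq_self hc] at hm
  unfold eulerDefect
  rw [Set.pair_comm σ α, Set.pair_comm σ (α * Equiv.swap a b), ← mul_assoc]
  have hcard : numOrbits (insert (α * Equiv.swap a b) {σ}) ≤ numOrbits (insert α {σ}) + 1 := by
    rw [numOrbits_eq_card, numOrbits_eq_card, ← hm]
    by_cases h' : orbitSetoid (insert (α * Equiv.swap a b) {σ}) a b
    · rw [Setoid.merge_eq_self h']; omega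
    · exact (Setoid.card_merge_of_not_rel h').le
  -- If `a` and `b` lie on one face, it splits, which pays together with the new `α`-orbit for at
  -- most one new component. Otherwise two faces join, which offsets the new `α`-orbit, and the
  -- joined face keeps `a` and `b` in one component.
  by_cases hs : (σ * α).SameCycle a b
  · have := numOrbits_mul_swap hab hs
    omega
  · have h1 := numOrbits_mul_swap_of_not hs
    have h2 := sameCycle_mul_swap hs
    have hle' : orbitSetoid {σ * α * Equiv.swap a b}
        ≤ orbitSetoid (insert (α * Equiv.swap a b) {σ}) := by
      refine orbitSetoid_le fun p hp x => orbitSetoid_of_mem_closure ?_ x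
      rw [Set.mem_singleton_iff.1 hp, mul_assoc]
      exact mul_mem (Subgroup.subset_closure (by simp)) (Subgroup.subset_closure (by simp))
    have h3 := hle' (orbitSetoid_singleton.2 h2)
    rw [Setoid.merge_eq_self h3] at hm
    have : numOrbits (insert (α * Equiv.swap a b) {σ}) = numOrbits (insert α {σ}) := by
      rw [numOrbits_eq_card, numOrbits_eq_card, hm]
    omega

/-- Deleting all edges outside a set `C` of edge ends does not increase the genus. -/
theorem eulerDefect_le_of_restrict (σ α β : Equiv.Perm A) (C : Set A) (hα : ∀ x, α (α x) = x)
    (hin : ∀ x ∈ C, β x = α x) (hout : ∀ x ∉ C, β x = x) :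
    eulerDefect σ α ≤ eulerDefect σ β := by
  classical
  have := Fintype.ofFinite A
  induction hn : α.support.card using Nat.strong_induction_on generalizing α with
  | _ n ih =>
  by_cases hex : ∃ a, a ∉ C ∧ α a ≠ a
  · obtain ⟨a, haC, ha⟩ := hex
    have hαC : α a ∉ C := by
      intro h
      apply ha
      have h1 := hin _ h
      rw [hα, ← hout a haC] at h1
      rw [← hout a haC]
      exact β.injective (h1.trans rfl) |>.trans (hout a haC).symm
    set α' := α * Equiv.swap a (α a)
    have h1 : α' a = a := by simp [α', hα]
    have h2 : α' (α a) = α a := by simp [α']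
    have h3 : ∀ x, x ≠ a → x ≠ α a → α' x = α x := fun x hx hx' => by
      simp [α', Equiv.swap_apply_of_ne_of_ne hx hx']
    refine (eulerDefect_le_mul_swap σ α ha.symm ⟨1, by simp⟩).trans
      (ih α'.support.card ?_ α' ?_ ?_ rfl)
    · rw [← hn]
      refine Finset.card_lt_card (Finset.ssubset_iff_subset_ne.2 ⟨fun x hx => ?_, fun he => ?_⟩)
      · rw [Equiv.Perm.mem_support] at hx ⊢
        by_cases hxa : x = a
        · rw [hxa]; exact ha
        by_cases hxb : x = α a
        · rw [hxb, hα]; exact ha.symm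
        · rwa [h3 x hxa hxb] at hx
      · have : a ∈ α.support := Equiv.Perm.mem_support.2 ha
        rw [← he, Equiv.Perm.mem_support] at this
        exact this h1
    · intro x
      by_cases hxa : x = a
      · rw [hxa, h1, h1]
      by_cases hxb : x = α a
      · rw [hxb, h2, h2]
      · rw [h3 x hxa hxb, h3 _ (fun h => hxb (by rw [← h, hα])) (fun h => hxa (α.injective h)), hα]
    · intro x hx
      rw [h3 x (fun h => haC (h ▸ hx)) (fun h => hαC (h ▸ hx))]
      exact hin x hx
  · push Not at hex
    have : α = β := by
      ext x
      by_cases hx : x ∈ C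
      · rw [hin x hx]
      · rw [hout x hx, hex x hx]
    rw [this]

/-- The number of orbits of an involution. -/
theorem two_mul_numOrbits_add_card_support [Fintype A] [DecidableEq A] {β : Equiv.Perm A}
    (hβ : ∀ x, β (β x) = x) :
    2 * numOrbits {β} + β.support.card = 2 * Fintype.card A := by
  classical
  have hcard : (Finset.univ.filter fun x => β x = x).card + β.support.card = Fintype.card A := by
    rw [← Finset.card_univ]
    exact Finset.card_filter_add_card_filter_not (s := Finset.univ) (fun x => β x = x)
  have hrel : ∀ x y, orbitSetoid {β} x y ↔ y = x ∨ y = β x := by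
    intro x y
    rw [orbitSetoid_singleton]
    constructor
    · intro h
      obtain ⟨i, -, rfl⟩ := h.exists_pow_eq'
      induction i with
      | zero => simp
      | succ i ih =>
        rw [pow_succ', Equiv.Perm.mul_apply]
        rcases ih ⟨i, by simp⟩ with h | h
        · right; rw [h]
        · left; rw [h, hβ]
    · rintro (rfl | rfl)
      · exact .refl _ _
      · exact ⟨1, by simp⟩
  -- Weight 2 on fixed points and 1 elsewhere gives every orbit total weight 2.
  have hsum : ∑ x, (1 + if β x = x then 1 else 0) = 2 * numOrbits {β} := by
    have := Fintype.ofFinite (Quotient (orbitSetoid {β}))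
    rw [numOrbits_eq_card, Nat.card_eq_fintype_card, ← Finset.card_univ, mul_comm,
      ← smul_eq_mul, ← Finset.sum_const,
      ← Finset.sum_fiberwise Finset.univ (fun x => Quotient.mk (orbitSetoid {β}) x)]
    refine Finset.sum_congr rfl fun q _ => ?_
    induction q using Quotient.inductionOn with | _ x => ?_
    have : (Finset.univ.filter fun y => Quotient.mk (orbitSetoid {β}) y = Quotient.mk _ x)
        = {x, β x} := by
      ext y
      simp only [Finset.mem_filter, Finset.mem_univ, true_and, Finset.mem_insert,
        Finset.mem_singleton]
      rw [eq_comm, ← hrel]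
      exact ⟨fun h => Quotient.exact h, fun h => Quotient.sound h⟩
    rw [this]
    by_cases hx : β x = x
    · simp [hx]
    · rw [Finset.sum_pair (Ne.symm hx), hβ, if_neg hx, if_neg (Ne.symm hx)]
  rw [Finset.sum_add_distrib, Finset.sum_boole] at hsum
  simp at hsum
  omega

end Orbits

end FlowNetwork

/-! ### Changes of a predicate along cycles, and the flow-carrying subgraph -/

namespace FlowNetwork

/-- Around an invariant set of a permutation, the changes of a predicate come in pairs. -/
theorem card_filter_change {A : Type*} (τ : Equiv.Perm A) (e : A → Prop) [DecidablePred e]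
    (s : Finset A) (hs : ∀ x, τ x ∈ s ↔ x ∈ s) :
    (s.filter fun x => ¬ (e (τ x) ↔ e x)).card
      = 2 * (s.filter fun x => e x ∧ ¬ e (τ x)).card := by
  -- As `τ` permutes `s`, there are as many changes from true to false as from false to true.
  have h1 : (s.filter fun x => e (τ x)).card = (s.filter e).card := by
    refine Finset.card_bij (fun x _ => τ x) ?_ (fun _ _ _ _ h => τ.injective h) ?_
    · intro x hx
      simpa [hs] using hx
    · intro y hy
      exact ⟨τ.symm y, by simpa [← hs (τ.symm y)] using hy, by simp⟩
  have h2 := Finset.card_filter_add_card_filter_not (s := s.filter e) (fun x => e (τ x))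
  have h3 := Finset.card_filter_add_card_filter_not (s := s.filter fun x => e (τ x)) e
  have h4 := Finset.card_filter_add_card_filter_not
    (s := s.filter fun x => ¬ (e (τ x) ↔ e x)) e
  simp only [Finset.filter_filter] at h2 h3 h4
  have h5 : (s.filter fun x => e x ∧ e (τ x)) = s.filter fun x => e (τ x) ∧ e x :=
    Finset.filter_congr fun x _ => and_comm
  have h6 : (s.filter fun x => ¬ (e (τ x) ↔ e x) ∧ e x) = s.filter fun x => e x ∧ ¬ e (τ x) :=
    Finset.filter_congr fun x _ => by tauto
  have h7 : (s.filter fun x => ¬ (e (τ x) ↔ e x) ∧ ¬ e x) = s.filter fun x => e (τ x) ∧ ¬ e x :=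
    Finset.filter_congr fun x _ => by tauto
  rw [h6, h7] at h4
  rw [h5] at h2
  omega

/-- A predicate that is constant along every step of a permutation is constant on its cycles. -/
theorem iff_of_sameCycle {A : Type*} {τ : Equiv.Perm A} {e : A → Prop} {x y : A}
    (h : τ.SameCycle x y) (hc : ∀ z, τ.SameCycle x z → (e (τ z) ↔ e z)) : e y ↔ e x := by
  have key : ∀ n : ℕ, ∀ z, τ.SameCycle x z → (e ((τ ^ n) z) ↔ e z) := by
    intro n
    induction n with
    | zero => simp
    | succ n ih =>
      intro z hz
      rw [pow_succ', Equiv.Perm.mul_apply, hc _ (hz.trans ⟨n, by simp⟩), ih z hz]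
  obtain ⟨i, rfl⟩ := h
  rcases Int.eq_nat_or_neg i with ⟨n, rfl | rfl⟩
  · exact key n x (.refl _ _)
  · have := key n ((τ ^ (-(n : ℤ))) x) ⟨_, rfl⟩
    have hz : (τ ^ n) ((τ ^ (-(n : ℤ))) x) = x := by simp
    rw [hz] at this
    exact this.symm

/-- Going once around a cycle of a permutation closes up a path of a relation. -/
theorem transGen_of_cycle {A V : Type*} [Finite A] {R : V → V → Prop} {τ : Equiv.Perm A}
    {t : A → V} {x : A} (hx : Relation.TransGen R (t x) (t (τ x)))
    (h : ∀ y, τ.SameCycle x y → Relation.ReflTransGen R (t y) (t (τ y))) :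
    Relation.TransGen R (t x) (t x) := by
  have key : ∀ n : ℕ, Relation.TransGen R (t x) (t ((τ ^ (n + 1)) x)) := by
    intro n
    induction n with
    | zero => simpa using hx
    | succ n ih =>
      rw [pow_succ', Equiv.Perm.mul_apply]
      exact ih.trans_left (h _ ⟨(n + 1 : ℕ), by rw [zpow_natCast]⟩)
  obtain ⟨i, hi, h⟩ := isOfFinOrder_iff_pow_eq_one.1 (isOfFinOrder_of_finite τ)
  have := key (i - 1)
  rwa [Nat.sub_add_cancel hi, h] at this

variable {V A : Type*} {N : FlowNetwork V A} {f : A → ℝ≥0}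

theorem head_rev (a : A) : N.head (N.rev a) = N.tail a := by
  rw [head, N.rev_rev]

theorem carriesFlow_rev {a : A} : N.CarriesFlow f (N.rev a) ↔ N.CarriesFlow f a := by
  simp only [CarriesFlow, N.rev_rev]
  exact or_comm

/-- An acyclic flow does not use an arc together with its reversal. -/
theorem IsAcyclic.eq_zero_of_pos (h : N.IsAcyclic f) {a : A} (ha : 0 < f a) :
    f (N.rev a) = 0 := by
  by_contra hr
  exact h (N.tail a) (.head ⟨a, rfl, rfl, ha⟩
    (.single ⟨N.rev a, rfl, head_rev a, pos_iff_ne_zero.2 hr⟩))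

theorem IsAcyclic.pos_rev_iff (h : N.IsAcyclic f) {a : A} (ha : N.CarriesFlow f a) :
    0 < f (N.rev a) ↔ ¬ 0 < f a := by
  constructor
  · intro h1 h2
    rw [h.eq_zero_of_pos h2] at h1
    exact lt_irrefl _ h1
  · exact fun h' => ha.resolve_left h'

open Classical in
/-- The involution that exchanges the two ends of each edge that carries flow and fixes all other
edge ends. -/
noncomputable def flowRev (N : FlowNetwork V A) (f : A → ℝ≥0) : Equiv.Perm A :=
  Function.Involutive.toPerm (fun a => if N.CarriesFlow f a then N.rev a else a) <| by
    intro a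
    by_cases h : N.CarriesFlow f a
    · simp [h, carriesFlow_rev.2 h, N.rev_rev]
    · simp [h]

theorem flowRev_of_carriesFlow {a : A} (h : N.CarriesFlow f a) : N.flowRev f a = N.rev a :=
  if_pos h

theorem flowRev_of_not {a : A} (h : ¬ N.CarriesFlow f a) : N.flowRev f a = a :=
  if_neg h

theorem flowRev_flowRev (a : A) : N.flowRev f (N.flowRev f a) = a :=
  Function.Involutive.toPerm_involutive _ a

namespace PlaneEmbedding

variable (P : N.PlaneEmbedding)

theorem sameCycle_next_iff {a b : A} : P.next.SameCycle a b ↔ N.tail a = N.tail b := by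
  refine ⟨?_, P.sameCycle_next a b⟩
  intro h
  have := iff_of_sameCycle (e := fun x => N.tail x = N.tail a) h (fun z _ => by rw [P.tail_next])
  exact (this.2 rfl).symm

/-- The first flow-carrying end at or after `a` around its vertex exists and is outgoing. -/
def NextOutgoing (f : A → ℝ≥0) (a : A) : Prop :=
  ∃ n : ℕ, N.CarriesFlow f ((P.next ^ n) a) ∧
    (∀ m < n, ¬ N.CarriesFlow f ((P.next ^ m) a)) ∧ 0 < f ((P.next ^ n) a)

theorem nextOutgoing_iff_of_first {a : A} {n : ℕ} (hn : N.CarriesFlow f ((P.next ^ n) a))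
    (hlt : ∀ m < n, ¬ N.CarriesFlow f ((P.next ^ m) a)) :
    P.NextOutgoing f a ↔ 0 < f ((P.next ^ n) a) := by
  constructor
  · rintro ⟨m, hm, hm', hpos⟩
    have : m = n := by
      rcases lt_trichotomy m n with h | h | h
      · exact (hlt m h hm).elim
      · exact h
      · exact (hm' n h hn).elim
    rwa [← this]
  · exact fun h => ⟨n, hn, hlt, h⟩

theorem nextOutgoing_of_carriesFlow {a : A} (h : N.CarriesFlow f a) :
    P.NextOutgoing f a ↔ 0 < f a :=
  P.nextOutgoing_iff_of_first (n := 0) h (by simp)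

theorem nextOutgoing_next_of_not {a : A} (h : ¬ N.CarriesFlow f a) :
    P.NextOutgoing f (P.next a) ↔ P.NextOutgoing f a := by
  constructor
  · rintro ⟨n, h1, h2, h3⟩
    refine ⟨n + 1, h1, fun m hm => ?_, h3⟩
    cases m with
    | zero => exact h
    | succ m => exact h2 m (by omega)
  · rintro ⟨n, h1, h2, h3⟩
    cases n with
    | zero => exact (h h1).elim
    | succ n => exact ⟨n, h1, fun m hm => h2 (m + 1) (by omega), h3⟩

/-- `NextOutgoing` extends the direction of each flow-carrying end backwards over the idle ends
before it. A direction change thus becomes a change across a single step of `next`, to which the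
counting of changes applies. -/
theorem isDirectionChange_iff [Finite A] {a : A} :
    P.IsDirectionChange f a ↔ ¬ (P.NextOutgoing f (P.next a) ↔ P.NextOutgoing f a) := by
  constructor
  · rintro ⟨h, n, h1, h2, h3⟩
    rwa [P.nextOutgoing_of_carriesFlow h, P.nextOutgoing_iff_of_first (a := P.next a) h1 h2]
  · intro hne
    have h : N.CarriesFlow f a := by
      by_contra h
      exact hne (P.nextOutgoing_next_of_not h)
    have hex : ∃ n, N.CarriesFlow f ((P.next ^ (n + 1)) a) := by
      obtain ⟨i, hi, h'⟩ := isOfFinOrder_iff_pow_eq_one.1 (isOfFinOrder_of_finite P.next)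
      exact ⟨i - 1, by rwa [Nat.sub_add_cancel hi, h']⟩
    classical
    refine ⟨h, Nat.find hex, Nat.find_spec hex, fun m hm => Nat.find_min hex hm, ?_⟩
    rwa [P.nextOutgoing_of_carriesFlow h, P.nextOutgoing_iff_of_first (a := P.next a)
      (Nat.find_spec hex) (fun m hm => Nat.find_min hex hm)] at hne

/-! ### Counting direction changes at vertices and faces; Euler's formula -/

section Counting

variable [Fintype A]

open Classical in
theorem alternation_eq_card (v : V) : P.alternation f v
    = (Finset.univ.filter fun a => N.tail a = v ∧
        ¬ (P.NextOutgoing f (P.next a) ↔ P.NextOutgoing f a)).card := by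
  rw [alternation, ← Set.ncard_coe_finset]
  congr 1
  ext a
  simp [isDirectionChange_iff]

theorem even_alternation (v : V) : Even (P.alternation f v) := by
  classical
  rw [alternation_eq_card, ← Finset.filter_filter,
    card_filter_change P.next (P.NextOutgoing f) _ (by simp [P.tail_next])]
  exact even_two_mul _

/-- An end that carries flow is a direction change of exactly one of its vertex and its face. -/
theorem card_changes (h : N.IsAcyclic f) [DecidablePred (P.NextOutgoing f)]
    [DecidablePred (N.CarriesFlow f)] :
    (Finset.univ.filter fun a => ¬ (P.NextOutgoing f (P.next a) ↔ P.NextOutgoing f a)).card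
      + (Finset.univ.filter fun a =>
        ¬ (P.NextOutgoing f ((P.next * N.flowRev f) a) ↔ P.NextOutgoing f a)).card
      = (Finset.univ.filter (N.CarriesFlow f)).card := by
  rw [← Finset.card_filter_add_card_filter_not (s := Finset.univ.filter (N.CarriesFlow f))
    (fun a => ¬ (P.NextOutgoing f (P.next a) ↔ P.NextOutgoing f a))]
  simp only [Finset.filter_filter]
  congr 1
  · refine congrArg _ (Finset.filter_congr fun a _ => ?_)
    have := P.nextOutgoing_next_of_not (f := f) (a := a)
    tauto
  -- Passing to the other end of an edge flips outgoing and incoming, so a face change at `a` is a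
  -- non-change at the vertex at the reversed end.
  · have key : ∀ a, (¬ (P.NextOutgoing f ((P.next * N.flowRev f) a) ↔ P.NextOutgoing f a)) ↔
        (N.CarriesFlow f (N.flowRev f a) ∧ ¬ ¬ (P.NextOutgoing f (P.next (N.flowRev f a)) ↔
          P.NextOutgoing f (N.flowRev f a))) := by
      intro a
      rw [Equiv.Perm.mul_apply]
      by_cases ha : N.CarriesFlow f a
      · rw [flowRev_of_carriesFlow ha, P.nextOutgoing_of_carriesFlow (carriesFlow_rev.2 ha),
          P.nextOutgoing_of_carriesFlow ha, h.pos_rev_iff ha, carriesFlow_rev]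
        tauto
      · rw [flowRev_of_not ha, P.nextOutgoing_next_of_not ha]
        tauto
    refine Finset.card_bij (fun a _ => N.flowRev f a) ?_ (fun _ _ _ _ h => (N.flowRev f).injective h)
      ?_
    · intro a ha
      exact Finset.mem_filter.2 ⟨Finset.mem_univ _, (key a).1 (Finset.mem_filter.1 ha).2⟩
    · intro b hb
      refine ⟨N.flowRev f b, Finset.mem_filter.2 ⟨Finset.mem_univ _, (key _).2 ?_⟩,
        flowRev_flowRev b⟩
      rw [flowRev_flowRev]
      exact (Finset.mem_filter.1 hb).2

/-- A face whose boundary carries flow has a direction change. -/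
theorem not_carriesFlow_of_face (h : N.IsAcyclic f) {a : A}
    (hc : ∀ b, (P.next * N.flowRev f).SameCycle a b →
      (P.NextOutgoing f ((P.next * N.flowRev f) b) ↔ P.NextOutgoing f b)) :
    ¬ N.CarriesFlow f a := by
  intro ha
  have htail : ∀ b, N.CarriesFlow f b → N.tail ((P.next * N.flowRev f) b) = N.head b := by
    intro b hb
    rw [Equiv.Perm.mul_apply, P.tail_next, flowRev_of_carriesFlow hb, head]
  have htail' : ∀ b, ¬ N.CarriesFlow f b → N.tail ((P.next * N.flowRev f) b) = N.tail b := by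
    intro b hb
    rw [Equiv.Perm.mul_apply, P.tail_next, flowRev_of_not hb]
  have hconst : ∀ b, (P.next * N.flowRev f).SameCycle a b → N.CarriesFlow f b →
      (0 < f b ↔ 0 < f a) := by
    intro b hb hb'
    rw [← P.nextOutgoing_of_carriesFlow ha, ← P.nextOutgoing_of_carriesFlow hb']
    exact iff_of_sameCycle hb hc
  by_cases hpos : 0 < f a
  · have step : ∀ b, (P.next * N.flowRev f).SameCycle a b → N.CarriesFlow f b →
        N.FlowStep f (N.tail b) (N.tail ((P.next * N.flowRev f) b)) := fun b hb hb' =>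
      ⟨b, rfl, (htail b hb').symm, (hconst b hb hb').2 hpos⟩
    refine h _ (transGen_of_cycle (τ := P.next * N.flowRev f) (t := N.tail)
      (.single (step a (.refl _ _) ha)) fun b hb => ?_)
    by_cases hb' : N.CarriesFlow f b
    · exact .single (step b hb hb')
    · rw [htail' b hb']
  -- Here every edge of the face is traversed against the flow; the boundary read backwards is the
  -- directed cycle.
  · have step : ∀ b, (P.next * N.flowRev f).SameCycle a b → N.CarriesFlow f b →
        Function.swap (N.FlowStep f) (N.tail b) (N.tail ((P.next * N.flowRev f) b)) :=
      fun b hb hb' => ⟨N.rev b, (htail b hb').symm, head_rev b,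
        hb'.resolve_left (mt (hconst b hb hb').1 hpos)⟩
    have := transGen_of_cycle (τ := P.next * N.flowRev f) (t := N.tail)
      (.single (step a (.refl _ _) ha)) fun b hb => by
        by_cases hb' : N.CarriesFlow f b
        · exact .single (step b hb hb')
        · rw [htail' b hb']
    exact h _ (Relation.transGen_swap.1 this)

theorem numOrbits_next [DecidableEq V] : numOrbits {P.next} = (Finset.univ.image N.tail).card := by
  have : orbitSetoid {P.next} = Setoid.ker N.tail := by
    ext a b
    rw [orbitSetoid_singleton, P.sameCycle_next_iff, Setoid.ker_def]
  rw [numOrbits_eq_card, this, Nat.card_congr (Setoid.quotientKerEquivRange _),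
    Nat.card_coe_set_eq, ← Set.ncard_coe_finset]
  simp

/-- As `rev` has no fixed points, its orbit count minus `Nat.card A` is minus the number of edges,
and `planar` applies. -/
theorem eulerDefect_rev : eulerDefect P.next N.rev = 0 := by
  classical
  have h := two_mul_numOrbits_add_card_support N.rev_rev
  have hs : N.rev.support = Finset.univ := by
    ext a; simp [N.rev_ne]
  rw [hs, Finset.card_univ] at h
  have := P.planar
  rw [eulerDefect, Nat.card_eq_fintype_card]
  omega

open Classical in
/-- The vertices that are neither isolated nor incident to an edge that carries flow. -/
noncomputable def idle (N : FlowNetwork V A) (f : A → ℝ≥0) : Finset V :=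
  (Finset.univ.image N.tail).filter fun v => ¬ N.IsActive f v

open Classical in
theorem numOrbits_next_eq [Fintype V] :
    numOrbits {P.next} = (Finset.univ.filter (N.IsActive f)).card + (idle N f).card := by
  rw [numOrbits_next, ← Finset.card_filter_add_card_filter_not (N.IsActive f), idle]
  congr 2
  ext v
  simp only [Finset.mem_filter, Finset.mem_image, Finset.mem_univ, true_and, and_iff_right_iff_imp]
  rintro ⟨a, ha, -⟩
  exact ⟨a, ha⟩

/-- Each idle vertex is a component of its own, and there is one more component if some edge
carries flow. -/
theorem card_idle_lt {a : A} (ha : N.CarriesFlow f a) :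
    (idle N f).card + 1 ≤ numOrbits {P.next, N.flowRev f} := by
  classical
  set r := orbitSetoid {P.next, N.flowRev f}
  have hr : ∀ x y, r x y → ¬ N.IsActive f (N.tail x) → N.tail y = N.tail x := by
    -- This invariant lumps all active vertices together and keeps each idle vertex apart; both
    -- generators preserve it.
    let s : Setoid A := Setoid.ker fun x => if N.IsActive f (N.tail x) then none else
      some (N.tail x)
    have hle : r ≤ s := by
      refine orbitSetoid_le fun p hp x => ?_
      change (if _ then _ else _) = if _ then _ else _
      rcases hp with rfl | hp
      · rw [P.tail_next]
      · rw [Set.mem_singleton_iff.1 hp]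
        by_cases hx : N.CarriesFlow f x
        · rw [if_pos ⟨x, rfl, hx⟩, flowRev_of_carriesFlow hx,
            if_pos ⟨N.rev x, rfl, carriesFlow_rev.2 hx⟩]
        · rw [flowRev_of_not hx]
    intro x y hxy hx
    have h : (if _ then _ else _) = if _ then _ else _ := hle hxy
    rw [if_neg hx] at h
    split_ifs at h
    exact (Option.some.inj h).symm
  have := Fintype.ofFinite (Quotient r)
  have hrep : ∀ v : V, ∃ x : A, v ∈ idle N f → N.tail x = v := by
    intro v
    by_cases hv : v ∈ idle N f
    · obtain ⟨x, -, hx⟩ := Finset.mem_image.1 (Finset.mem_filter.1 hv).1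
      exact ⟨x, fun _ => hx⟩
    · exact ⟨a, fun h => (hv h).elim⟩
  choose rep hrep using hrep
  have hidle : ∀ v ∈ idle N f, ¬ N.IsActive f v := fun v hv => (Finset.mem_filter.1 hv).2
  rw [numOrbits_eq_card, Nat.card_eq_fintype_card]
  have hnot : Quotient.mk r a ∉ (idle N f).image fun v => Quotient.mk r (rep v) := by
    rw [Finset.mem_image]
    rintro ⟨v, hv, h⟩
    have h1 := hr _ _ (Quotient.exact h) (by rw [hrep v hv]; exact hidle v hv)
    rw [hrep v hv] at h1
    exact hidle v hv ⟨a, h1, ha⟩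
  have hinj : Set.InjOn (fun v => Quotient.mk r (rep v)) (idle N f) := by
    intro v hv w hw h
    have h1 := hr _ _ (Quotient.exact h) (by rw [hrep v hv]; exact hidle v hv)
    rw [hrep v hv, hrep w hw] at h1
    exact h1.symm
  rw [← Finset.card_image_of_injOn hinj, ← Finset.card_insert_of_notMem hnot]
  exact Finset.card_le_univ _

/-- The faces of the flow graph: each one is an idle vertex or has two direction changes. -/
theorem two_mul_numOrbits_face_le (h : N.IsAcyclic f) [DecidablePred (P.NextOutgoing f)] :
    2 * numOrbits {P.next * N.flowRev f} ≤ 2 * (idle N f).card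
      + (Finset.univ.filter fun a =>
        ¬ (P.NextOutgoing f ((P.next * N.flowRev f) a) ↔ P.NextOutgoing f a)).card := by
  classical
  set φ := P.next * N.flowRev f with hφ
  set r := orbitSetoid {φ}
  have := Fintype.ofFinite (Quotient r)
  set D := Finset.univ.filter fun a => ¬ (P.NextOutgoing f (φ a) ↔ P.NextOutgoing f a)
  set Q := D.image (Quotient.mk r)
  have hQ : 2 * Q.card ≤ D.card := by
    rw [Finset.card_eq_sum_card_image (Quotient.mk r) D, mul_comm, ← smul_eq_mul]
    refine Finset.card_nsmul_le_sum _ _ _ fun q hq => ?_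
    obtain ⟨a, ha, rfl⟩ := Finset.mem_image.1 hq
    have hpos : 0 < (D.filter fun b => Quotient.mk r b = Quotient.mk r a).card :=
      Finset.card_pos.2 ⟨a, by simp [ha]⟩
    rw [Finset.filter_comm, card_filter_change φ (P.NextOutgoing f)] at hpos ⊢
    · omega
    all_goals
      intro x
      have : Quotient.mk r (φ x) = Quotient.mk r x :=
        Quotient.sound (r.symm (orbitSetoid_of_mem (Set.mem_singleton φ) x))
      simp [this]
  -- A face without changes carries no flow, so the face permutation acts on it as `next`; the face
  -- is then the full rotation at one idle vertex.
  have hcompl : Qᶜ.card ≤ (idle N f).card := by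
    have hq : ∀ q ∈ Qᶜ, ∀ b, Quotient.mk r b = q →
        (P.NextOutgoing f (φ b) ↔ P.NextOutgoing f b) := by
      intro q hq b hb
      by_contra hne
      exact Finset.mem_compl.1 hq (Finset.mem_image.2 ⟨b, by simp [D, hne], hb⟩)
    have hcarry : ∀ q ∈ Qᶜ, ∀ b, Quotient.mk r b = q → ¬ N.CarriesFlow f b := by
      rintro q hq' b rfl
      refine P.not_carriesFlow_of_face h fun c hc => hq _ hq' c ?_
      exact Quotient.sound (r.symm (orbitSetoid_singleton.2 hc))
    have hpow : ∀ q ∈ Qᶜ, ∀ b, Quotient.mk r b = q → ∀ n : ℕ,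
        Quotient.mk r ((P.next ^ n) b) = q := by
      intro q hq' b hb n
      induction n with
      | zero => exact hb
      | succ n ih =>
        have : φ ((P.next ^ n) b) = (P.next ^ (n + 1)) b := by
          rw [hφ, Equiv.Perm.mul_apply, flowRev_of_not (hcarry q hq' _ ih), pow_succ',
            Equiv.Perm.mul_apply]
        rw [← this, ← ih]
        exact Quotient.sound (r.symm (orbitSetoid_of_mem (Set.mem_singleton φ) _))
    have hvert : ∀ q ∈ Qᶜ, ∀ b c, Quotient.mk r b = q → N.tail b = N.tail c →
        Quotient.mk r c = q := by
      intro q hq' b c hb hbc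
      obtain ⟨n, -, rfl⟩ := (P.sameCycle_next b c hbc).exists_pow_eq'
      exact hpow q hq' b hb n
    refine Finset.card_le_card_of_injOn (fun q => N.tail q.out) (fun q hq' => ?_) ?_
    · refine Finset.mem_filter.2 ⟨by simp, ?_⟩
      rintro ⟨c, hc, hc'⟩
      exact hcarry q hq' c (hvert q hq' _ c q.out_eq hc.symm) hc'
    · intro q hq' q' _ hqq
      rw [← hvert q hq' _ _ q.out_eq hqq, q'.out_eq]
  have hQc := Finset.card_add_card_compl Q
  rw [numOrbits_eq_card, Nat.card_eq_fintype_card]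
  change 2 * Fintype.card (Quotient r) ≤ _
  omega

open Classical in
/-- Euler's formula for an acyclic flow graph. -/
theorem sum_alternation_add_four_le [Fintype V] (h : N.IsAcyclic f) {a : A}
    (ha : N.CarriesFlow f a) :
    ∑ v with N.IsActive f v, P.alternation f v + 4
      ≤ 2 * (Finset.univ.filter (N.IsActive f)).card := by
  have h1 := P.card_changes h
  have h2 := P.two_mul_numOrbits_face_le h
  have h3 := P.card_idle_lt ha
  have h4 := P.numOrbits_next_eq (f := f)
  have h5 := two_mul_numOrbits_add_card_support (flowRev_flowRev (N := N) (f := f))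
  have h6 := eulerDefect_le_of_restrict P.next N.rev (N.flowRev f) {a | N.CarriesFlow f a}
    N.rev_rev (fun _ => flowRev_of_carriesFlow) (fun _ => flowRev_of_not)
  rw [P.eulerDefect_rev, eulerDefect, Nat.card_eq_fintype_card] at h6
  have h7 : (N.flowRev f).support = Finset.univ.filter (N.CarriesFlow f) := by
    ext x
    rw [Equiv.Perm.mem_support, Finset.mem_filter_univ]
    by_cases hx : N.CarriesFlow f x
    · simp [flowRev_of_carriesFlow hx, N.rev_ne, hx]
    · simp [flowRev_of_not hx, hx]
  have h8 : ∑ v with N.IsActive f v, P.alternation f v = (Finset.univ.filter fun a =>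
      ¬ (P.NextOutgoing f (P.next a) ↔ P.NextOutgoing f a)).card := by
    rw [Finset.card_eq_sum_card_fiberwise (f := N.tail) (t := Finset.univ.filter (N.IsActive f))]
    · refine Finset.sum_congr rfl fun v _ => ?_
      rw [alternation_eq_card, Finset.filter_filter]
      simp only [and_comm]
    · intro x hx
      refine Finset.mem_coe.2 (Finset.mem_filter.2 ⟨Finset.mem_univ _, x, rfl, ?_⟩)
      by_contra hc
      exact (Finset.mem_filter.1 hx).2 (P.nextOutgoing_next_of_not hc)
  rw [h7] at h5
  -- Doubling `h6` and inserting the other counts, the idle vertices cancel: each adds one vertex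
  -- and at most one face, but also one component, which counts twice.
  omega

end Counting

end PlaneEmbedding

end FlowNetwork

/-! ### Inflow and outflow in `G_st` and after the cycle replacement -/

namespace FlowNetwork

variable {V A : Type*}

theorem inflow_eq_sum [Fintype A] {N : FlowNetwork V A} {f : A → ℝ≥0} {v : V} {s : Finset A}
    (hs : ∀ a, N.head a = v ↔ a ∈ s) : N.inflow f v = ∑ a ∈ s, f a := by
  classical
  exact Finset.sum_congr (Finset.ext fun a => by rw [Finset.mem_filter_univ, hs]) fun _ _ => rfl

theorem outflow_eq_sum [Fintype A] {N : FlowNetwork V A} {f : A → ℝ≥0} {v : V} {s : Finset A}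
    (hs : ∀ a, N.tail a = v ↔ a ∈ s) : N.outflow f v = ∑ a ∈ s, f a := by
  classical
  exact Finset.sum_congr (Finset.ext fun a => by rw [Finset.mem_filter_univ, hs]) fun _ _ => rfl

section ReplaceByCycles

variable (N : FlowNetwork V A)

theorem port_eq_inl_iff {a : A} {x : N.FiniteEnd} : N.port a = .inl x ↔ a = x.1 := by
  unfold port
  split_ifs with h
  · simp only [false_iff]
    rintro rfl
    exact x.2 h
  · rw [Sum.inl.injEq, Subtype.ext_iff]

theorem port_eq_inr_iff {a : A} {v : {v : V // N.vcap v = ⊤}} :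
    N.port a = .inr v ↔ N.tail a = v.1 := by
  unfold port
  split_ifs with h
  · rw [Sum.inr.injEq, Subtype.ext_iff]
  · simp only [false_iff]
    intro h'
    exact h (h' ▸ v.2)

variable {next : Equiv.Perm A} (hnext : ∀ a, N.tail (next a) = N.tail a)
  [Fintype N.CycleArc] (g : N.CycleArc → ℝ≥0)

/-- The tags keep the two cycle arcs distinct even at a vertex of degree 1, where `y = x`. -/
theorem inflow_replaceByCycles_inl (x y : N.FiniteEnd) (hxy : next y.1 = x.1) :
    (N.replaceByCycles next hnext).inflow g (.inl x)
      = g (.inl (N.rev x.1)) + (g (.inr (y, true)) + g (.inr (x, false))) := by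
  classical
  have : ∀ a, (N.replaceByCycles next hnext).head a = .inl x ↔
      a ∈ ({.inl (N.rev x.1), .inr (y, true), .inr (x, false)} : Finset N.CycleArc) := by
    intro a
    rcases a with a | ⟨z, b⟩
    · have : (N.replaceByCycles next hnext).head (.inl a) = N.port (N.rev a) := rfl
      rw [this, port_eq_inl_iff]
      simp only [Finset.mem_insert, Finset.mem_singleton, Sum.inl.injEq, reduceCtorEq, or_false]
      exact ⟨fun h => by rw [← h, N.rev_rev], fun h => by rw [h, N.rev_rev]⟩
    · cases b
      · have : (N.replaceByCycles next hnext).head (.inr (z, false)) = .inl z := rfl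
        rw [this]
        simp
      · have : (N.replaceByCycles next hnext).head (.inr (z, true))
            = .inl ⟨next z.1, by rw [hnext]; exact z.2⟩ := rfl
        rw [this]
        simp only [Sum.inl.injEq, Subtype.ext_iff, ← hxy, Finset.mem_insert, Finset.mem_singleton,
          reduceCtorEq, Sum.inr.injEq, Prod.mk.injEq, false_or, and_true, Bool.true_eq_false,
          and_false, or_false, next.injective.eq_iff]
  rw [inflow_eq_sum this, Finset.sum_insert (by simp), Finset.sum_pair (by simp)]

theorem outflow_replaceByCycles_inl (x y : N.FiniteEnd) (hxy : next y.1 = x.1) :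
    (N.replaceByCycles next hnext).outflow g (.inl x)
      = g (.inl x.1) + (g (.inr (x, true)) + g (.inr (y, false))) := by
  classical
  have : ∀ a, (N.replaceByCycles next hnext).tail a = .inl x ↔
      a ∈ ({.inl x.1, .inr (x, true), .inr (y, false)} : Finset N.CycleArc) := by
    intro a
    rcases a with a | ⟨z, b⟩
    · have : (N.replaceByCycles next hnext).tail (.inl a) = N.port a := rfl
      rw [this, port_eq_inl_iff]
      simp
    · cases b
      · have : (N.replaceByCycles next hnext).tail (.inr (z, false))
            = .inl ⟨next z.1, by rw [hnext]; exact z.2⟩ := rfl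
        rw [this]
        simp only [Sum.inl.injEq, Subtype.ext_iff, ← hxy, Finset.mem_insert, Finset.mem_singleton,
          reduceCtorEq, Sum.inr.injEq, Prod.mk.injEq, false_or, and_true, Bool.false_eq_true,
          and_false, next.injective.eq_iff]
      · have : (N.replaceByCycles next hnext).tail (.inr (z, true)) = .inl z := rfl
        rw [this]
        simp
  rw [outflow_eq_sum this, Finset.sum_insert (by simp), Finset.sum_pair (by simp)]

theorem inflow_replaceByCycles_inr [Fintype A] (v : {v : V // N.vcap v = ⊤}) :
    (N.replaceByCycles next hnext).inflow g (.inr v) = N.inflow (fun a => g (.inl a)) v.1 := by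
  classical
  have : ∀ a, (N.replaceByCycles next hnext).head a = .inr v ↔
      a ∈ (Finset.univ.filter fun a => N.head a = v.1).map .inl := by
    intro a
    rcases a with a | ⟨z, b⟩
    · have : (N.replaceByCycles next hnext).head (.inl a) = N.port (N.rev a) := rfl
      rw [this, port_eq_inr_iff]
      change N.head a = v.1 ↔ _
      simp
    · have : ∃ y, (N.replaceByCycles next hnext).head (.inr (z, b)) = .inl y := by
        cases b <;> exact ⟨_, rfl⟩
      obtain ⟨y, hy⟩ := this
      simp [hy]
  rw [inflow_eq_sum this, Finset.sum_map]
  rfl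

theorem outflow_replaceByCycles_inr [Fintype A] (v : {v : V // N.vcap v = ⊤}) :
    (N.replaceByCycles next hnext).outflow g (.inr v) = N.outflow (fun a => g (.inl a)) v.1 := by
  classical
  have : ∀ a, (N.replaceByCycles next hnext).tail a = .inr v ↔
      a ∈ (Finset.univ.filter fun a => N.tail a = v.1).map .inl := by
    intro a
    rcases a with a | ⟨z, b⟩
    · have : (N.replaceByCycles next hnext).tail (.inl a) = N.port a := rfl
      rw [this, port_eq_inr_iff]
      simp
    · have : ∃ y, (N.replaceByCycles next hnext).tail (.inr (z, b)) = .inl y := by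
        cases b <;> exact ⟨_, rfl⟩
      obtain ⟨y, hy⟩ := this
      simp [hy]
  rw [outflow_eq_sum this, Finset.sum_map]
  rfl

end ReplaceByCycles

section StNetwork

variable (N : FlowNetwork V A) [Fintype A] [Fintype N.StArc] (g : N.StArc → ℝ≥0) {v : V}

theorem inflow_stNetwork_base (hv : v ∉ N.S ∪ N.T) :
    N.stNetwork.inflow g (.base v) = N.inflow (fun a => g (.inl a)) v := by
  classical
  have : ∀ a, N.stNetwork.head a = .base v ↔
      a ∈ (Finset.univ.filter fun a => N.head a = v).map .inl := by
    intro a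
    rcases a with a | ⟨s | t, b⟩
    · have : N.stNetwork.head (.inl a) = .base (N.head a) := rfl
      rw [this]
      simp
    · cases b
      · have : N.stNetwork.head (.inr (.inl s, false)) = .supersource := rfl
        simp [this]
      · have : N.stNetwork.head (.inr (.inl s, true)) = .base s.1 := rfl
        simp only [this, StVertex.base.injEq, Finset.mem_map, Finset.mem_filter,
          Function.Embedding.inl_apply, reduceCtorEq, and_false, exists_false, iff_false]
        rintro rfl
        exact hv (.inl s.2)
    · cases b
      · have : N.stNetwork.head (.inr (.inr t, false)) = .base t.1 := rfl
        simp only [this, StVertex.base.injEq, Finset.mem_map, Finset.mem_filter,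
          Function.Embedding.inl_apply, reduceCtorEq, and_false, exists_false, iff_false]
        rintro rfl
        exact hv (.inr t.2)
      · have : N.stNetwork.head (.inr (.inr t, true)) = .supersink := rfl
        simp [this]
  rw [inflow_eq_sum this, Finset.sum_map]
  rfl

theorem outflow_stNetwork_base (hv : v ∉ N.S ∪ N.T) :
    N.stNetwork.outflow g (.base v) = N.outflow (fun a => g (.inl a)) v := by
  classical
  have : ∀ a, N.stNetwork.tail a = .base v ↔
      a ∈ (Finset.univ.filter fun a => N.tail a = v).map .inl := by
    intro a
    rcases a with a | ⟨s | t, b⟩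
    · have : N.stNetwork.tail (.inl a) = .base (N.tail a) := rfl
      rw [this]
      simp
    · cases b
      · have : N.stNetwork.tail (.inr (.inl s, false)) = .base s.1 := rfl
        simp only [this, StVertex.base.injEq, Finset.mem_map, Finset.mem_filter,
          Function.Embedding.inl_apply, reduceCtorEq, and_false, exists_false, iff_false]
        rintro rfl
        exact hv (.inl s.2)
      · have : N.stNetwork.tail (.inr (.inl s, true)) = .supersource := rfl
        simp [this]
    · cases b
      · have : N.stNetwork.tail (.inr (.inr t, false)) = .supersink := rfl
        simp [this]
      · have : N.stNetwork.tail (.inr (.inr t, true)) = .base t.1 := rfl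
        simp only [this, StVertex.base.injEq, Finset.mem_map, Finset.mem_filter,
          Function.Embedding.inl_apply, reduceCtorEq, and_false, exists_false, iff_false]
        rintro rfl
        exact hv (.inr t.2)
  rw [outflow_eq_sum this, Finset.sum_map]
  rfl

end StNetwork

/-! ### Bounding the inflow through the cycle flows -/

section Extended

variable [Fintype A] {G : FlowNetwork V A} {P : G.PlaneEmbedding}

theorem inflow_eq_sum_tail (N : FlowNetwork V A) (f : A → ℝ≥0) [DecidableEq V] (v : V) :
    N.inflow f v = ∑ a with N.tail a = v, f (N.rev a) := by
  rw [inflow_eq_sum (s := Finset.univ.filter fun a => N.head a = v) (by simp)]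
  refine Finset.sum_equiv N.rev (fun a => ?_) (fun a _ => by rw [N.rev_rev])
  rw [Finset.mem_filter_univ, Finset.mem_filter_univ, head]

/-- The net outflow at `v` of the restricted flow, weighted by `u`. -/
theorem sum_weighted_netflow {v : V} {f : A → ℝ≥0} {r : A → ℝ} [DecidableEq V]
    (hr : ∀ a, G.tail a = v → (f (P.next a) : ℝ) - f (G.rev (P.next a)) = r (P.next a) - r a)
    (u : A → ℝ) :
    ∑ a with G.tail a = v, u a * ((f a : ℝ) - f (G.rev a))
      = ∑ a with G.tail a = v, (u a - u (P.next a)) * r a := by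
  have shift : ∀ w : A → ℝ, ∑ a with G.tail a = v, w a = ∑ a with G.tail a = v, w (P.next a) := by
    intro w
    refine (Finset.sum_equiv P.next (fun a => ?_) (fun a _ => rfl)).symm
    simp [P.tail_next]
  rw [shift]
  have : ∑ a with G.tail a = v, u (P.next a) * ((f (P.next a) : ℝ) - f (G.rev (P.next a)))
      = ∑ a with G.tail a = v, (u (P.next a) * r (P.next a) - u (P.next a) * r a) := by
    refine Finset.sum_congr rfl fun a ha => ?_
    rw [hr a (Finset.mem_filter.1 ha).2, mul_sub]
  -- Summation by parts; there is no boundary term because the ends are in cyclic order.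
  rw [this, Finset.sum_sub_distrib, ← shift fun a => u a * r a, ← Finset.sum_sub_distrib]
  exact Finset.sum_congr rfl fun a _ => (sub_mul _ _ _).symm

variable [Fintype V] {g : G.ExtArc → ℝ≥0}

/-- Conservation in the extended graph at a vertex of infinite capacity. -/
theorem IsFeasible.inflow_eq_outflow_of_vcap_eq_top (hg : (G.extended P).IsFeasible g) {v : V}
    (hv : v ∉ G.S ∪ G.T) (htop : G.vcap v = ⊤) :
    G.inflow (G.restrict g) v = G.outflow (G.restrict g) v := by
  classical
  have : Fintype G.StArc := Fintype.ofFinite _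
  have h := hg.1 (.inr ⟨.base v, htop⟩) (by
    rintro (h | h) <;> cases h)
  rw [extended, inflow_replaceByCycles_inr, outflow_replaceByCycles_inr, inflow_stNetwork_base _ _ hv,
    outflow_stNetwork_base _ _ hv] at h
  exact h

/-- The net counterclockwise flow on the cycle edges of the extended graph. -/
theorem IsFeasible.exists_cycle_flow (hg : (G.extended P).IsFeasible g) :
    ∃ r : A → ℝ, ∀ a, G.vcap (G.tail a) ≠ ⊤ →
      |r a| ≤ (G.vcap (G.tail a)).toReal / 2 ∧
      (G.restrict g (P.next a) : ℝ) - G.restrict g (G.rev (P.next a)) = r (P.next a) - r a := by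
  classical
  let x : ∀ a, G.vcap (G.tail a) ≠ ⊤ → G.stNetwork.FiniteEnd := fun a h => ⟨.inl a, h⟩
  refine ⟨fun a => if h : G.vcap (G.tail a) ≠ ⊤ then
    (g (.inr (x a h, false)) : ℝ) - g (.inr (x a h, true)) else 0, fun a h => ?_⟩
  have h' : G.vcap (G.tail (P.next a)) ≠ ⊤ := by rwa [P.tail_next]
  simp only [dif_pos h, dif_pos h']
  constructor
  · have hle : ∀ b, (g (.inr (x a h, b)) : ℝ) ≤ (G.vcap (G.tail a)).toReal / 2 := by
      intro b
      have h1 : (g (.inr (x a h, b)) : ℝ≥0∞) ≤ G.vcap (G.tail a) / 2 := hg.2.1 (.inr (x a h, b))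
      have h2 := ENNReal.toReal_mono (ENNReal.div_ne_top h (by norm_num)) h1
      simpa using h2
    have h0 := hle true
    have h1 := hle false
    have h2 : (0 : ℝ) ≤ g (.inr (x a h, true)) := NNReal.coe_nonneg _
    have h3 : (0 : ℝ) ≤ g (.inr (x a h, false)) := NNReal.coe_nonneg _
    rw [abs_le]
    constructor <;> linarith
  -- The port of `next a` meets exactly the cycle edges indexed by `a` and `next a`.
  · have hc := hg.1 (.inl (x (P.next a) h')) (by rintro (h | h) <;> cases h)
    rw [extended, inflow_replaceByCycles_inl (y := x a h) (hxy := rfl),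
      outflow_replaceByCycles_inl (y := x a h) (hxy := rfl)] at hc
    have hc' := congrArg (fun z : ℝ≥0 => (z : ℝ)) hc
    simp only [NNReal.coe_add] at hc'
    have e1 : G.restrict g (P.next a) = g (.inl (x (P.next a) h').1) := rfl
    have e2 : G.restrict g (G.rev (P.next a)) = g (.inl (G.stNetwork.rev (x (P.next a) h').1)) := rfl
    rw [e1, e2]
    linarith

/-- At a finite capacity, the constant weight `1` makes the cycle contributions cancel. -/
theorem IsFeasible.isFlow_restrict (hg : (G.extended P).IsFeasible g) :
    G.IsFlow (G.restrict g) := by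
  classical
  intro v hv
  by_cases htop : G.vcap v = ⊤
  · exact hg.inflow_eq_outflow_of_vcap_eq_top hv htop
  obtain ⟨r, hr⟩ := hg.exists_cycle_flow
  have h := sum_weighted_netflow (G := G) (P := P) (v := v) (f := G.restrict g) (r := r)
    (fun a ha => (hr a (by rwa [ha])).2) (fun _ => 1)
  simp only [one_mul, sub_self, zero_mul, Finset.sum_const_zero, Finset.sum_sub_distrib] at h
  rw [inflow_eq_sum_tail, outflow, ← NNReal.coe_inj]
  push_cast
  linarith

/-- Each direction change at `v` accounts for at most `c(v) / 2` units of incoming flow. -/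
theorem IsFeasible.inflow_le_alternation (hg : (G.extended P).IsFeasible g)
    (hacyc : G.IsAcyclic (G.restrict g)) {v : V} (htop : G.vcap v ≠ ⊤) :
    (G.inflow (G.restrict g) v : ℝ)
      ≤ P.alternation (G.restrict g) v * ((G.vcap v).toReal / 2) := by
  classical
  set f := G.restrict g
  obtain ⟨r, hr⟩ := hg.exists_cycle_flow
  -- The weighted sum then picks out the inflow, since by acyclicity no edge carries flow both ways;
  -- and `u` jumps, by one, only at direction changes.
  let u : A → ℝ := fun a => if P.NextOutgoing f a then 0 else -1
  have h := sum_weighted_netflow (G := G) (P := P) (v := v) (f := f) (r := r)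
    (fun a ha => (hr a (by rwa [ha])).2) u
  have hin : (G.inflow f v : ℝ) = ∑ a with G.tail a = v, u a * ((f a : ℝ) - f (G.rev a)) := by
    rw [inflow_eq_sum_tail, NNReal.coe_sum]
    refine Finset.sum_congr rfl fun a _ => ?_
    by_cases ha : G.CarriesFlow f a
    · by_cases hpos : 0 < f a
      · simp [u, (P.nextOutgoing_of_carriesFlow ha).2 hpos, hacyc.eq_zero_of_pos hpos]
      · have h0 : f a = 0 := by simpa using hpos
        simp [u, mt (P.nextOutgoing_of_carriesFlow ha).1 hpos, h0]
    · simp only [CarriesFlow, not_or, not_lt, nonpos_iff_eq_zero] at ha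
      simp [ha.1, ha.2]
  rw [hin, h, P.alternation_eq_card, ← Finset.filter_filter, ← nsmul_eq_mul, ← Finset.sum_const]
  refine (Finset.sum_le_sum fun a ha => ?_).trans_eq (Finset.sum_filter _ _).symm
  have ha' := (Finset.mem_filter.1 ha).2
  have hra := (hr a (by rwa [ha'])).1
  rw [ha', abs_le] at hra
  by_cases h1 : P.NextOutgoing f a <;> by_cases h2 : P.NextOutgoing f (P.next a) <;>
    simp [u, h1, h2] <;> linarith

end Extended

/-! ### Summing the index over saddles -/

namespace PlaneEmbedding

variable [Fintype A] {N : FlowNetwork V A} (P : N.PlaneEmbedding) {f : A → ℝ≥0}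

/-- Flow that passes through a vertex changes direction there. -/
theorem two_le_alternation (hf : N.IsFlow f) (hacyc : N.IsAcyclic f) {v : V} (hv : v ∉ N.S ∪ N.T)
    (hact : N.IsActive f v) : 2 ≤ P.alternation f v := by
  classical
  have hio := hf v hv
  have hin : 0 < N.inflow f v := by
    obtain ⟨a, ha, h | h⟩ := hact
    · rw [hio]
      exact Finset.sum_pos' (fun _ _ => zero_le) ⟨a, by simp [ha], h⟩
    · exact Finset.sum_pos' (fun _ _ => zero_le) ⟨N.rev a, by simp [head_rev, ha], h⟩
  have hout := hio ▸ hin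
  obtain ⟨a, ha, hapos⟩ := Finset.exists_ne_zero_of_sum_ne_zero hin.ne'
  obtain ⟨b, hb, hbpos⟩ := Finset.exists_ne_zero_of_sum_ne_zero hout.ne'
  rw [Finset.mem_filter_univ] at ha hb
  have hapos' : 0 < f a := pos_iff_ne_zero.2 hapos
  have hbpos' : 0 < f b := pos_iff_ne_zero.2 hbpos
  -- Without a change, `NextOutgoing` would be constant around `v`, although `v` has both an
  -- incoming and an outgoing flow arc. Parity then yields two changes.
  have h0 : P.alternation f v ≠ 0 := by
    intro h0
    rw [P.alternation_eq_card, Finset.card_eq_zero, Finset.filter_eq_empty_iff] at h0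
    have hs : P.next.SameCycle (N.rev a) b := P.sameCycle_next _ _ (ha.trans hb.symm)
    have := iff_of_sameCycle (e := P.NextOutgoing f) hs fun z hz => by
      have := h0 (Finset.mem_univ z)
      rw [← P.sameCycle_next_iff.1 hz] at this
      exact not_not.1 fun hne => this ⟨ha, hne⟩
    rw [P.nextOutgoing_of_carriesFlow (.inl hbpos'),
      P.nextOutgoing_of_carriesFlow (carriesFlow_rev.2 (.inl hapos')),
      hacyc.eq_zero_of_pos hapos'] at this
    exact lt_irrefl _ (this.1 hbpos')
  obtain ⟨m, hm⟩ := P.even_alternation (f := f) v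
  omega

/-- The total index of the saddles. -/
theorem sum_index_saddle_le [Fintype V] [DecidablePred (P.IsSaddle f)] (hf : N.IsFlow f)
    (hacyc : N.IsAcyclic f) {k : ℕ} (hk : k = N.S.ncard + N.T.ncard) (hk2 : 2 ≤ k) :
    ∑ v with P.IsSaddle f v, P.index f v ≤ (k : ℝ) - 2 := by
  classical
  have hkR : (2 : ℝ) ≤ k := by exact_mod_cast hk2
  have hactive : ∀ v, P.IsSaddle f v → N.IsActive f v := by
    intro v hv
    have hne : {a | N.tail a = v ∧ P.IsDirectionChange f a}.ncard ≠ 0 := by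
      have h4 : 4 ≤ P.alternation f v := hv
      rw [alternation] at h4
      omega
    obtain ⟨a, ha, hc, -⟩ := Set.nonempty_of_ncard_ne_zero hne
    exact ⟨a, ha, hc⟩
  by_cases hex : ∃ a, N.CarriesFlow f a
  · obtain ⟨a, ha⟩ := hex
    have heuler := P.sum_alternation_add_four_le hacyc ha
    have hindex : ∑ v with N.IsActive f v, P.index f v ≤ -2 := by
      have h' : ((∑ v with N.IsActive f v, P.alternation f v + 4 : ℕ) : ℝ)
          ≤ ((2 * (Finset.univ.filter (N.IsActive f)).card : ℕ) : ℝ) := by exact_mod_cast heuler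
      push_cast at h'
      simp only [index, Finset.sum_sub_distrib, ← Finset.sum_div, Finset.sum_const, nsmul_eq_mul,
        mul_one]
      linarith
    have hsplit := Finset.sum_filter_add_sum_filter_not (Finset.univ.filter (N.IsActive f))
      (P.IsSaddle f) (P.index f)
    have hs : (Finset.univ.filter (N.IsActive f)).filter (P.IsSaddle f)
        = Finset.univ.filter (P.IsSaddle f) := by
      rw [Finset.filter_filter]
      exact Finset.filter_congr fun v _ => ⟨fun h => h.2, fun h => ⟨hactive v h, h⟩⟩
    -- Terminals have index at least `-1`, and other active vertices at least `0`.
    have hrest : -(k : ℝ) ≤ ∑ v ∈ (Finset.univ.filter (N.IsActive f)).filter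
        (fun v => ¬ P.IsSaddle f v), P.index f v := by
      have hcard : ((Finset.univ.filter fun v => v ∈ N.S ∪ N.T).card : ℝ) ≤ k := by
        rw [hk]
        have : (Finset.univ.filter fun v => v ∈ N.S ∪ N.T).card = (N.S ∪ N.T).ncard := by
          rw [← Set.ncard_coe_finset]
          congr 1
          ext v
          simp
        rw [this]
        exact_mod_cast Set.ncard_union_le _ _
      calc -(k : ℝ) ≤ ∑ v with v ∈ N.S ∪ N.T, (-1 : ℝ) := by
            rw [Finset.sum_const, nsmul_eq_mul]; linarith
        _ = ∑ v, if v ∈ N.S ∪ N.T then (-1 : ℝ) else 0 := Finset.sum_filter _ _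
        _ ≤ ∑ v ∈ (Finset.univ.filter (N.IsActive f)).filter (fun v => ¬ P.IsSaddle f v),
            if v ∈ N.S ∪ N.T then (-1 : ℝ) else 0 := by
          rw [← Finset.sum_filter_add_sum_filter_not Finset.univ fun v =>
            N.IsActive f v ∧ ¬ P.IsSaddle f v, ← Finset.filter_filter]
          refine add_le_of_nonpos_right (Finset.sum_nonpos fun v _ => ?_)
          split_ifs <;> norm_num
        _ ≤ _ := by
          refine Finset.sum_le_sum fun v hv => ?_
          rw [Finset.mem_filter, Finset.mem_filter] at hv
          split_ifs with hvt
          · have : (0 : ℝ) ≤ P.alternation f v := Nat.cast_nonneg _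
            rw [index]; linarith
          · have : (2 : ℝ) ≤ P.alternation f v := by
              exact_mod_cast P.two_le_alternation hf hacyc hvt hv.1.2
            rw [index]; linarith
    rw [hs] at hsplit
    linarith
  -- Without flow there are no saddles, and the bound is `0 ≤ k - 2`.
  · rw [Finset.filter_false_of_mem fun v _ hv => hex ?_]
    · simpa using hkR
    · obtain ⟨a, -, ha⟩ := hactive v hv
      exact ⟨a, ha⟩

end PlaneEmbedding

end FlowNetwork

/-! ### Excess bounds and the main theorem -/

namespace FlowNetwork

section Excess

variable {V A : Type*} {G : FlowNetwork V A} {P : G.PlaneEmbedding} {v : V}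

theorem PlaneEmbedding.index_nonneg_of_two_le {f : A → ℝ≥0} (h : 2 ≤ P.alternation f v) :
    0 ≤ P.index f v := by
  have : (2 : ℝ) ≤ P.alternation f v := by exact_mod_cast h
  rw [index]
  linarith

theorem PlaneEmbedding.one_le_index_of_isSaddle {f : A → ℝ≥0} (h : P.IsSaddle f v) :
    1 ≤ P.index f v := by
  have : (4 : ℝ) ≤ P.alternation f v := by exact_mod_cast h
  rw [index]
  linarith

variable [Fintype V] [Fintype A] {g : G.ExtArc → ℝ≥0}

theorem IsFeasible.excess_le (hg : (G.extended P).IsFeasible g)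
    (hacyc : G.IsAcyclic (G.restrict g)) :
    G.excess (G.restrict g) v ≤ ENNReal.ofReal (P.index (G.restrict g) v) * G.vcap v := by
  by_cases htop : G.vcap v = ⊤
  · simp [excess, htop]
  have h := hg.inflow_le_alternation hacyc htop
  obtain ⟨c, hc⟩ : ∃ c : ℝ≥0, (c : ℝ≥0∞) = G.vcap v := ⟨_, ENNReal.coe_toNNReal htop⟩
  rw [excess, ← hc, tsub_le_iff_right]
  rw [← hc, ENNReal.coe_toReal] at h
  -- The maximum matches the truncation in `ENNReal.ofReal`: the index is `-1` where there is no
  -- change.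
  have hi : (P.alternation (G.restrict g) v : ℝ) / 2 ≤ max (P.index (G.restrict g) v) 0 + 1 := by
    have := le_max_left (P.index (G.restrict g) v) 0
    rw [PlaneEmbedding.index] at this ⊢
    linarith
  rw [ENNReal.ofReal, ← ENNReal.coe_mul, ← ENNReal.coe_add, ENNReal.coe_le_coe, ← NNReal.coe_le_coe]
  push_cast
  rw [Real.coe_toNNReal']
  nlinarith [mul_le_mul_of_nonneg_right hi c.coe_nonneg]

/-- A vertex that receives more flow than its capacity is a saddle. -/
theorem IsFeasible.isSaddle_of_isInfeasibleAt (hg : (G.extended P).IsFeasible g)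
    (hacyc : G.IsAcyclic (G.restrict g)) (hv : G.IsInfeasibleAt (G.restrict g) v) :
    P.IsSaddle (G.restrict g) v := by
  have h := hg.excess_le hacyc (v := v)
  have hpos : 0 < G.excess (G.restrict g) v := tsub_pos_of_lt hv
  have hi : 0 < P.index (G.restrict g) v := by
    by_contra hi
    rw [ENNReal.ofReal_of_nonpos (not_lt.1 hi), zero_mul] at h
    exact hpos.not_ge h
  -- Parity lifts `α > 2` to `α ≥ 4`.
  have h2 : 2 < P.alternation (G.restrict g) v := by
    rw [PlaneEmbedding.index] at hi
    have : (2 : ℝ) < P.alternation (G.restrict g) v := by linarith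
    exact_mod_cast this
  obtain ⟨m, hm⟩ := P.even_alternation (f := G.restrict g) v
  change 4 ≤ _
  omega

end Excess

end FlowNetwork

open Classical in
theorem mainTheorem4 {V A : Type*} [Fintype V] [Fintype A]
    (G : FlowNetwork V A) (P : G.PlaneEmbedding)
    (hdisj : Disjoint G.S G.T)
    (hS_in : ∀ a, G.head a ∈ G.S → G.cap a = 0)
    (hT_out : ∀ a, G.tail a ∈ G.T → G.cap a = 0)
    (hterm : ∀ v ∈ G.S ∪ G.T, G.vcap v = ⊤)
    (k : ℕ) (hk : k = G.S.ncard + G.T.ncard) (hk2 : 2 ≤ k)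
    (g : G.ExtArc → ℝ≥0) (hg : (G.extended P).IsFeasible g)
    (f : A → ℝ≥0) (hf : f = G.restrict g) (hacyc : G.IsAcyclic f) :
    -- the restriction is a flow that respects the arc capacities
    (G.IsFlow f ∧ G.RespectsArcCapacities f) ∧
    -- the excess bound at the non-terminal vertices of the flow graph
    (∀ v, v ∉ G.S ∪ G.T → G.IsActive f v →
      (G.excess f v : EReal) ≤ ((P.index f v : ℝ) : EReal) * (G.vcap v : EReal)) ∧
    -- only saddles are infeasible
    (∀ v, G.IsInfeasibleAt f v → P.IsSaddle f v) ∧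
    -- the saddle-index bound
    (∑ v with P.IsSaddle f v, P.index f v ≤ (k : ℝ) - 2) ∧
    -- the number of infeasible vertices
    {v | G.IsInfeasibleAt f v}.ncard ≤ k - 2 ∧
    -- the total excess, where `U` bounds the finite vertex capacities
    (∀ U : ℝ≥0, (∀ v, G.vcap v ≠ ⊤ → G.vcap v ≤ U) →
      ∑ v, G.excess f v ≤ ((k - 2 : ℕ) : ℝ≥0∞) * U) := by

  classical
  subst hf
  have hflow := hg.isFlow_restrict
  have hsad : ∀ v, G.IsInfeasibleAt (G.restrict g) v → P.IsSaddle (G.restrict g) v :=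
    fun v => hg.isSaddle_of_isInfeasibleAt hacyc
  have hsum := P.sum_index_saddle_le hflow hacyc hk hk2
  have hkcast : ((k - 2 : ℕ) : ℝ) = (k : ℝ) - 2 := by push_cast [hk2]; rfl
  refine ⟨⟨hflow, fun a => hg.2.1 (.inl (.inl a))⟩, fun v hv hact => ?_, hsad, hsum, ?_,
    fun U hU => ?_⟩
  -- At an active non-terminal the index is nonnegative, so the truncated bound is the exact one.
  · have h := EReal.coe_ennreal_le_coe_ennreal_iff.2 (hg.excess_le hacyc (v := v))
    rwa [EReal.coe_ennreal_mul, EReal.coe_ennreal_ofReal, max_eq_left] at h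
    exact FlowNetwork.PlaneEmbedding.index_nonneg_of_two_le
      (P.two_le_alternation hflow hacyc hv hact)
  · have hcard : ((Finset.univ.filter (P.IsSaddle (G.restrict g))).card : ℝ) ≤ (k : ℝ) - 2 := by
      refine le_trans ?_ hsum
      rw [← nsmul_one, ← Finset.sum_const]
      exact Finset.sum_le_sum fun v hv =>
        FlowNetwork.PlaneEmbedding.one_le_index_of_isSaddle (Finset.mem_filter.1 hv).2
    rw [← hkcast, Nat.cast_le] at hcard
    refine le_trans ?_ hcard
    rw [← Set.ncard_coe_finset]
    exact Set.ncard_le_ncard fun v hv => by simpa using hsad v hv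
  · calc ∑ v, G.excess (G.restrict g) v
        = ∑ v with P.IsSaddle (G.restrict g) v, G.excess (G.restrict g) v := by
          rw [Finset.sum_filter_of_ne]
          intro v _ hne
          exact hsad v (lt_of_not_ge fun hle => hne (tsub_eq_zero_of_le hle))
      _ ≤ ∑ v with P.IsSaddle (G.restrict g) v, ENNReal.ofReal (P.index (G.restrict g) v) * U := by
          refine Finset.sum_le_sum fun v _ => ?_
          -- `U` bounds only finite capacities; at an infinite one the excess is `0`.
          by_cases htop : G.vcap v = ⊤
          · simp [FlowNetwork.excess, htop]
          · exact (hg.excess_le hacyc).trans (by gcongr; exact hU v htop)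
      _ = ENNReal.ofReal (∑ v with P.IsSaddle (G.restrict g) v, P.index (G.restrict g) v) * U := by
          rw [← Finset.sum_mul, ENNReal.ofReal_sum_of_nonneg]
          intro v hv
          exact zero_le_one.trans
            (FlowNetwork.PlaneEmbedding.one_le_index_of_isSaddle (Finset.mem_filter.1 hv).2)
      _ ≤ ((k - 2 : ℕ) : ℝ≥0∞) * U := by
          gcongr
          rw [← ENNReal.ofReal_natCast, hkcast]
          exact ENNReal.ofReal_le_ofReal hsum
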